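/- Let $\Pi$ (policies) and $\mathcal O$ (observations) be measurable spaces such that $\Pi$ is countable or the $\sigma$-algebra of $\mathcal O$ is countably generated, and let $H\ge 0$ be an integer. Let $\mathcal P$ be a nonempty set of transition kernels $\mathsf P:\Pi\to\Delta(\mathcal O)$ and $\mathcal R$ a set of measurable mean reward functions $R=(R_h)_{h\le H}:\mathcal O\to[0,1]^H$; put $\mathcal M=\mathcal P\times\mathcal R$. For $\mathsf P\in\mathcal P$, $R\in\mathcal R$, $\pi\in\Pi$ let $$f^{\mathsf P,R}(\pi)=\mathbb E_{o\sim\mathsf P(\pi)}\Big[\sum_{h=1}^H R_h(o)\Big],\qquad f^{\mathsf P,R}(\pi_{\mathsf P,R})=\sup_{\pi\in\Pi}f^{\mathsf P,R}(\pi),\qquad g^{\mathsf P,R}(\pi)=f^{\mathsf P,R}(\pi_{\mathsf P,R})-f^{\mathsf P,R}(\pi).$$ For $\gamma>0$, $\mathcal P'\subseteq\mathcal P$ and $\overline{\mathsf P}\in\mathcal P$ define the reward-free decision-estimation coefficient of $\mathcal P'\times\mathcal R$ at the reference transition $\overline{\mathsf P}$ by $$\operatorname{rfdec}_\gamma(\mathcal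 P'\times\mathcal R,\overline{\mathsf P})=\inf_{p_{\rm exp}\in\Delta(\Pi)}\ \sup_{R\in\mathcal R}\ \inf_{p_{\rm out}\in\Delta(\Pi)}\ \sup_{\mathsf P\in\mathcal P'}\Big\{\mathbb E_{\pi\sim p_{\rm out}}\big[g^{\mathsf P,R}(\pi)\big]-\gamma\,\mathbb E_{\pi\sim p_{\rm exp}}\big[D_{\rm H}^2(\mathsf P(\pi),\overline{\mathsf P}(\pi))\big]\Big\},$$ where $D_{\rm H}^2(\mathbb P,\mathbb Q)=\int\big(\sqrt{d\mathbb P/d\lambda}-\sqrt{d\mathbb Q/d\lambda}\big)^2d\lambda$ for any measure $\lambda$ dominating $\mathbb P$ and $\mathbb Q$. For $\varepsilon\ge0$ let $$\mathcal M^{\infty,\rm rf}_\varepsilon(\overline{\mathsf P})=\big\{\mathsf P\in\mathcal P:\ |g^{\mathsf P,R}(\pi)-g^{\overline{\mathsf P},R}(\pi)|\le\varepsilon\ \ \forall \pi\in\Pi,\ R\in\mathcal R\big\}\times\mathcal R .$$ For an integer $T\ge1$ put $V(\mathcal M)=3\sup_{\mathsf P,\overline{\mathsf P}\in\mathcal P}\sup_{\pi\in\Pi}\sup_{A}\mathsf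 P(A|\pi)/\overline{\mathsf P}(A|\pi)$, with $A$ ranging over the measurable subsets of $\mathcal O$ (for discrete $\mathcal O$, equivalently over single observations; $0/0=0$ and $a/0=\infty$ for $a>0$), $C(T)=2^{13}\log(2T\wedge V(\mathcal M))$ and $\underline\epsilon_\gamma=\gamma/(C(T)\,T)$. A reward-free algorithm $\mathfrak A$ with $T$ episodes draws, in each episode $t\le T$, a policy $\pi^t$ from a distribution that depends measurably on the history $(\pi^s,o^s)_{s<t}$, then observes $o^t\sim\mathsf P(\pi^t)$ (no reward is observed), and after $T$ episodes returns a map $p_{\rm out}:\mathcal R\to\Delta(\Pi)$ that depends (for each $R$, measurably) on the whole history. Let $\mathbb E^{\mathsf P,\mathfrak A}$ be the expectation when $\mathfrak A$ interacts with $\mathsf P$ (a lower integral where the integrand is not measurable), and $$\mathbf{SubOpt}_{\rm rf}=\sup_{R\in\mathcal R}\Big\{f^{\mathsf P,R}(\pi_{\mathsf P,R})-\mathbb E_{\pi\sim p_{\rm out}(R)}\big[f^{\mathsf P,R}(\pi)\big]\Big\}.$$ Then for every such $\mathcal M=\mathcal P\times\mathcal R$, every $T\ge1$ and every reward-free algorithm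 $\mathfrak A$ with $T$ episodes there is a $\mathsf P\in\mathcal P$ with $$\mathbb E^{\mathsf P,\mathfrak A}\big[\mathbf{SubOpt}_{\rm rf}\big]\ \ge\ \sup_{R\in\mathcal R}\mathbb E^{\mathsf P,\mathfrak A}\Big[f^{\mathsf P,R}(\pi_{\mathsf P,R})-\mathbb E_{\pi\sim p_{\rm out}(R)}\big[f^{\mathsf P,R}(\pi)\big]\Big]\ \ge\ \frac16\,\sup_{\gamma>0}\ \sup_{\overline{\mathsf P}\in\mathcal P}\operatorname{rfdec}_\gamma\big(\mathcal M^{\infty,\rm rf}_{\underline\epsilon_\gamma}(\overline{\mathsf P}),\overline{\mathsf P}\big).$$ -/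

import Mathlib

open MeasureTheory ProbabilityTheory
open scoped ENNReal

noncomputable section

namespace RewardFree

/-- Squared Hellinger distance `∫ (√(dμ/dl) - √(dν/dl))² dl`, with the dominating measure
`l = μ + ν` (its value does not depend on the dominating measure). -/
def hellingerSq {X : Type*} [MeasurableSpace X] (μ ν : Measure X) : ℝ :=
  ∫ x, (√(μ.rnDeriv (μ + ν) x).toReal - √(ν.rnDeriv (μ + ν) x).toReal) ^ 2 ∂(μ + ν)

variable {Pol Obs : Type*} [MeasurableSpace Pol] [MeasurableSpace Obs] {H : ℕ}

/-- The value `f^{P,R}(π)`: the expected cumulative mean reward of the policy `π` when the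
observation is drawn from `P(π)`. -/
def value (P : Kernel Pol Obs) (R : Obs → Fin H → ℝ) (π : Pol) : ℝ :=
  ∫ o, ∑ h, R o h ∂(P π)

/-- The optimal value `f^{P,R}(π_{P,R}) = sup_π f^{P,R}(π)`. -/
def optValue (P : Kernel Pol Obs) (R : Obs → Fin H → ℝ) : ℝ :=
  ⨆ π, value P R π

/-- The suboptimality `g^{P,R}(π) = f^{P,R}(π_{P,R}) - f^{P,R}(π)`. -/
def gap (P : Kernel Pol Obs) (R : Obs → Fin H → ℝ) (π : Pol) : ℝ :=
  optValue P R - value P R π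

/-- The reward-free DEC of the class `𝓟 × 𝓡` with respect to a distribution `μ` over
transitions. Infima and suprema are taken in the complete lattice `EReal`. -/
def rfdec (γ : ℝ) (𝓟 : Set (Kernel Pol Obs)) (𝓡 : Set (Obs → Fin H → ℝ))
    (μ : PMF (Kernel Pol Obs)) : EReal :=
  ⨅ pexp : ProbabilityMeasure Pol, ⨆ R ∈ 𝓡, ⨅ pout : ProbabilityMeasure Pol, ⨆ P ∈ 𝓟,
    ((∫ π, gap P R π ∂(pout : Measure Pol)
      - γ * ∫ π, ∑' Q, (μ Q).toReal * hellingerSq (P π) (Q π) ∂(pexp : Measure Pol) : ℝ) : EReal)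

/-- The reward-free DEC with respect to a single reference transition `Pbar`, that is, with
respect to the point mass at `Pbar`. -/
def rfdecAt (γ : ℝ) (𝓟 : Set (Kernel Pol Obs)) (𝓡 : Set (Obs → Fin H → ℝ))
    (Pbar : Kernel Pol Obs) : EReal :=
  rfdec γ 𝓟 𝓡 (PMF.pure Pbar)

/-- The localized class of the transitions `P ∈ 𝓟` whose suboptimalities differ by at most `ε`
from those of `Pbar`, for all policies and all rewards in `𝓡`. -/
def localized (𝓟 : Set (Kernel Pol Obs)) (𝓡 : Set (Obs → Fin H → ℝ)) (ε : ℝ)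
    (Pbar : Kernel Pol Obs) : Set (Kernel Pol Obs) :=
  {P ∈ 𝓟 | ∀ π, ∀ R ∈ 𝓡, |gap P R π - gap Pbar R π| ≤ ε}

/-- `V = 3 sup_{P,Q} sup_π sup_A P(A|π)/Q(A|π)` over measurable events `A`. For discrete `Obs`
this is `3` times the supremum of the ratios `P(o|π)/Q(o|π)` over single observations, in general
the essential supremum of the ratio of the densities. Here `0/0 = 0` and `a/0 = ∞` for `a > 0`. -/
def ratioBound (𝓟 : Set (Kernel Pol Obs)) : ℝ≥0∞ :=
  3 * ⨆ P ∈ 𝓟, ⨆ Q ∈ 𝓟, ⨆ π : Pol, ⨆ A : Set Obs, ⨆ _ : MeasurableSet A, P π A / Q π A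

/-- `C(T) = 2^13 log (2T ∧ V)`. -/
def logConst (𝓟 : Set (Kernel Pol Obs)) (T : ℕ) : ℝ :=
  2 ^ 13 * Real.log (min (2 * (T : ℝ≥0∞)) (ratioBound 𝓟)).toReal

/-- The radius `γ / (C(T) T)`. -/
def radius (𝓟 : Set (Kernel Pol Obs)) (T : ℕ) (γ : ℝ) : ℝ :=
  γ / (logConst 𝓟 T * T)

/-- A reward-free algorithm with `T` exploration episodes. In episode `t + 1` (only `t < T`
matters) it draws a policy from `explore t`, given the history of the first `t` pairs
(policy, observation); after `T` episodes it returns a map from rewards `R ∈ 𝓡` to distributions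
over policies that depends on the history. -/
structure Algorithm (Pol Obs : Type*) [MeasurableSpace Pol] [MeasurableSpace Obs] {H : ℕ}
    (𝓡 : Set (Obs → Fin H → ℝ)) (T : ℕ) where
  explore : (t : ℕ) → Kernel (Fin t → Pol × Obs) Pol
  markov_explore : ∀ t, IsMarkovKernel (explore t)
  out : 𝓡 → Kernel (Fin T → Pol × Obs) Pol
  markov_out : ∀ R, IsMarkovKernel (out R)

namespace Algorithm

variable {𝓡 : Set (Obs → Fin H → ℝ)} {T : ℕ}

/-- The law of the first `t` pairs (policy, observation) when the algorithm interacts with `P`. -/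
def historyLaw (𝔄 : Algorithm Pol Obs 𝓡 T) (P : Kernel Pol Obs) :
    (t : ℕ) → Measure (Fin t → Pol × Obs)
  | 0 => Measure.dirac Fin.elim0
  | t + 1 => ((𝔄.historyLaw P t) ⊗ₘ
      (𝔄.explore t ⊗ₖ Kernel.prodMkLeft (Fin t → Pol × Obs) P)).map
        (fun x => (Fin.snoc x.1 x.2 : Fin (t + 1) → Pol × Obs))

/-- The suboptimality of the output for the reward `R`, given the history:
`f^{P,R}(π_{P,R}) - E_{π ∼ p_out(R)} f^{P,R}(π)`. -/
def subOptAt (𝔄 : Algorithm Pol Obs 𝓡 T) (P : Kernel Pol Obs) (R : 𝓡)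
    (h : Fin T → Pol × Obs) : ℝ :=
  optValue P (R : Obs → Fin H → ℝ) - ∫ π, value P (R : Obs → Fin H → ℝ) π ∂(𝔄.out R h)

/-- The reward-free suboptimality: the supremum of the (nonnegative) suboptimalities over all
rewards, given the history. -/
def subOptRF (𝔄 : Algorithm Pol Obs 𝓡 T) (P : Kernel Pol Obs) (h : Fin T → Pol × Obs) : ℝ≥0∞ :=
  ⨆ R : 𝓡, ENNReal.ofReal (𝔄.subOptAt P R h)

/-- The expected reward-free suboptimality (a lower integral where the supremum over an
uncountable class of rewards fails to be measurable). -/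
def expSubOptRF (𝔄 : Algorithm Pol Obs 𝓡 T) (P : Kernel Pol Obs) : ℝ≥0∞ :=
  ∫⁻ h, 𝔄.subOptRF P h ∂(𝔄.historyLaw P T)

end Algorithm

end RewardFree

end

/-! The proof compares, for a reference transition `Q` and an alternative `P`, the laws of the
history produced by the algorithm, with the infima in the decision-estimation coefficient
evaluated at the algorithm's own distributions under `Q`: `p_exp` is the average over the
episodes of the law of the explored policy, `p_out` the law of the final output. If the
coefficient exceeds `δ`, there are a reward `R` and a transition `P` in the localized class with
`E^Q[X] - γ D > δ`, where `X` is the suboptimality of the output under `P`, and `T * D` is the sum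
over the episodes of the expected squared Hellinger distances `S` between `P(π^t)` and `Q(π^t)`.

The change of measure is the bound `E^Q[y] ≤ 3 E^P[y] + 4 S` for functions `y` of the history with
values in `[0, 1]` (`Algorithm.integral_historyLaw_le`). It has no logarithmic factor and needs
no densities on the space of histories. It comes from the functional
`φ ↦ ∫ φ² dP_t + ∫ (1 - φ)² dQ_t`, whose infimum over test functions `φ` is `∫ p q / (p + q)`, half
the harmonic mean of the two laws, hence `1 / 2` when they agree. One episode lowers it by at most
the expected squared Hellinger distance of that episode
(`Algorithm.le_integral_sq_add_historyLaw`); the single-episode estimate is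
`le_integral_integral_sq_add`, which rests on the pointwise inequality `tangent_le_of_pos`.

Truncating `X` at the radius `ε` of the localized class makes the change of measure cost only
`4 ε S ≤ γ D`, while the part of `X` above `ε` is at most the suboptimality under `Q`, since the
gaps of `P` and `Q` differ by at most `ε`. Hence `δ < 3 E^P[X] + E^Q[X']`, with `X'` the
suboptimality under `Q`. So the coefficients are at most `4` times the supremum of the expected
suboptimalities, and the slack between `1 / 4` and `1 / 6` yields one transition that serves for
all `γ` and all reference transitions at once. -/

open MeasureTheory ProbabilityTheory
open scoped ENNReal

noncomputable section

namespace RewardFree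

/-! ### Squared Hellinger distance and quadratic test functions -/

/-- With `p = s²` and `q = r²`, the minimum over `f` of the right-hand side is
`b p q / (b p + q)` with `b = (1 - a) / a`, and `(1 - a) a p + (1 - a)² q` is its tangent
at `p = q`. The loss `(√p - √q)²` of the linearization is what the Hellinger distance pays for. -/
lemma tangent_le_of_pos {s r f a : ℝ} (h0 : 0 < a) (h1 : a ≤ 1) :
    (1 - a) * a * s ^ 2 + (1 - a) ^ 2 * r ^ 2 - (s - r) ^ 2
      ≤ (1 - a) / a * (f ^ 2 * s ^ 2) + (1 - f) ^ 2 * r ^ 2 := by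
  set m := (1 - a) * s ^ 2 + a * r ^ 2 with hm
  have hb : 0 ≤ 1 - a := by linarith
  have hm0 : 0 ≤ m := by positivity
  have key : 0 ≤ m * ((1 - a) * (f ^ 2 * s ^ 2) + a * ((1 - f) ^ 2 * r ^ 2)
      - a * ((1 - a) * a * s ^ 2 + (1 - a) ^ 2 * r ^ 2 - (s - r) ^ 2)) := by
    -- Expand `m` times the quadratic in `f` by completing the square; the rest is a multiple of
    -- `(s - r)²` because `m - a (1 - a) (s + r)² = ((1 - a) s - a r)²`.
    have h : m * ((1 - a) * (f ^ 2 * s ^ 2) + a * ((1 - f) ^ 2 * r ^ 2)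
      - a * ((1 - a) * a * s ^ 2 + (1 - a) ^ 2 * r ^ 2 - (s - r) ^ 2))
      = ((1 - a) * s ^ 2 * f - a * r ^ 2 * (1 - f)) ^ 2
        + a * (s - r) ^ 2 * ((1 - a) * ((1 - a) * s - a * r) ^ 2 + a * m) := by
      rw [hm]; ring
    rw [h]; positivity
  have hE : 0 ≤ (1 - a) * (f ^ 2 * s ^ 2) + a * ((1 - f) ^ 2 * r ^ 2)
      - a * ((1 - a) * a * s ^ 2 + (1 - a) ^ 2 * r ^ 2 - (s - r) ^ 2) := by
    rcases hm0.eq_or_lt with h | h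
    · have h2 : a * r ^ 2 = 0 := by
        nlinarith [mul_nonneg hb (sq_nonneg s), mul_nonneg h0.le (sq_nonneg r)]
      have h3 : (1 - a) * s ^ 2 = 0 := by linarith
      have hr : r = 0 := by simpa [h0.ne'] using h2
      subst hr
      have : (1 - a) * (f ^ 2 * s ^ 2) + a * ((1 - f) ^ 2 * 0 ^ 2)
        - a * ((1 - a) * a * s ^ 2 + (1 - a) ^ 2 * 0 ^ 2 - (s - 0) ^ 2)
        = ((1 - a) * s ^ 2) * (f ^ 2 - a ^ 2) + a * s ^ 2 := by ring
      rw [this, h3, zero_mul, zero_add]; positivity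
    · exact nonneg_of_mul_nonneg_right key h
  have : (1 - a) / a * (f ^ 2 * s ^ 2) + (1 - f) ^ 2 * r ^ 2
      - ((1 - a) * a * s ^ 2 + (1 - a) ^ 2 * r ^ 2 - (s - r) ^ 2)
      = ((1 - a) * (f ^ 2 * s ^ 2) + a * ((1 - f) ^ 2 * r ^ 2)
      - a * ((1 - a) * a * s ^ 2 + (1 - a) ^ 2 * r ^ 2 - (s - r) ^ 2)) / a := by
    field_simp
  have := div_nonneg hE h0.le
  linarith

lemma sq_mem_Icc {y : ℝ} (hy : y ∈ Set.Icc (0 : ℝ) 1) :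
    y ^ 2 ∈ Set.Icc (0 : ℝ) 1 ∧ (1 - y) ^ 2 ∈ Set.Icc (0 : ℝ) 1 := by
  obtain ⟨h, h'⟩ := hy
  exact ⟨⟨sq_nonneg _, by nlinarith⟩, ⟨sq_nonneg _, by nlinarith⟩⟩

section Hellinger
variable {X : Type*} [MeasurableSpace X]

lemma integrable_of_mem_Icc {f : X → ℝ} {μ : Measure X} [IsFiniteMeasure μ] {a b : ℝ}
    (hf : Measurable f) (h : ∀ x, f x ∈ Set.Icc a b) : Integrable f μ :=
  Integrable.of_mem_Icc a b hf.aemeasurable (.of_forall h)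

lemma integral_mem_Icc {f : X → ℝ} {μ : Measure X} [IsProbabilityMeasure μ] {a b : ℝ}
    (hf : Measurable f) (h : ∀ x, f x ∈ Set.Icc a b) : ∫ x, f x ∂μ ∈ Set.Icc a b := by
  have hi := integrable_of_mem_Icc (μ := μ) hf h
  constructor
  · simpa using integral_mono (integrable_const a) hi fun x => (h x).1
  · simpa using integral_mono hi (integrable_const b) fun x => (h x).2

variable (μ ν : Measure X) [IsProbabilityMeasure μ] [IsProbabilityMeasure ν]

lemma integrable_hellinger_integrand : Integrable (fun x =>
    (√(μ.rnDeriv (μ + ν) x).toReal - √(ν.rnDeriv (μ + ν) x).toReal) ^ 2) (μ + ν) := by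
  have hp : Integrable (fun x => (μ.rnDeriv (μ + ν) x).toReal) (μ + ν) :=
    Measure.integrable_toReal_rnDeriv
  have hq : Integrable (fun x => (ν.rnDeriv (μ + ν) x).toReal) (μ + ν) :=
    Measure.integrable_toReal_rnDeriv
  refine (hp.add hq).mono' ?_ (.of_forall fun x => ?_)
  · exact Measurable.aestronglyMeasurable (by fun_prop)
  · rw [Real.norm_of_nonneg (sq_nonneg _)]
    have h1 := Real.sq_sqrt (ENNReal.toReal_nonneg (a := μ.rnDeriv (μ + ν) x))
    have h2 := Real.sq_sqrt (ENNReal.toReal_nonneg (a := ν.rnDeriv (μ + ν) x))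
    have h3 := mul_nonneg (Real.sqrt_nonneg (μ.rnDeriv (μ + ν) x).toReal)
      (Real.sqrt_nonneg (ν.rnDeriv (μ + ν) x).toReal)
    simp only [Pi.add_apply]
    nlinarith

lemma hellingerSq_nonneg (μ ν : Measure X) : 0 ≤ hellingerSq μ ν :=
  integral_nonneg fun _ => sq_nonneg _

lemma integral_rnDeriv_add {f : X → ℝ} :
    ∫ x, (μ.rnDeriv (μ + ν) x).toReal * f x ∂(μ + ν) = ∫ x, f x ∂μ ∧
      ∫ x, (ν.rnDeriv (μ + ν) x).toReal * f x ∂(μ + ν) = ∫ x, f x ∂ν :=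
  ⟨integral_rnDeriv_smul (Measure.AbsolutelyContinuous.rfl.add_right ν),
    integral_rnDeriv_smul (by
      rw [add_comm]; exact Measure.AbsolutelyContinuous.rfl.add_right μ)⟩

lemma hellingerSq_le_two : hellingerSq μ ν ≤ 2 := by
  have hp : Integrable (fun x => (μ.rnDeriv (μ + ν) x).toReal) (μ + ν) :=
    Measure.integrable_toReal_rnDeriv
  have hq : Integrable (fun x => (ν.rnDeriv (μ + ν) x).toReal) (μ + ν) :=
    Measure.integrable_toReal_rnDeriv
  have h := integral_rnDeriv_add μ ν (f := fun _ => 1)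
  simp only [mul_one, integral_const, probReal_univ, smul_eq_mul] at h
  calc hellingerSq μ ν
      ≤ ∫ x, ((μ.rnDeriv (μ + ν) x).toReal + (ν.rnDeriv (μ + ν) x).toReal) ∂(μ + ν) := by
        refine integral_mono (integrable_hellinger_integrand μ ν) (hp.add hq) fun x => ?_
        have h1 := Real.sq_sqrt (ENNReal.toReal_nonneg (a := μ.rnDeriv (μ + ν) x))
        have h2 := Real.sq_sqrt (ENNReal.toReal_nonneg (a := ν.rnDeriv (μ + ν) x))
        have h3 := mul_nonneg (Real.sqrt_nonneg (μ.rnDeriv (μ + ν) x).toReal)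
          (Real.sqrt_nonneg (ν.rnDeriv (μ + ν) x).toReal)
        simp only
        nlinarith
    _ = 2 := by rw [integral_add hp hq, h.1, h.2]; norm_num

/-- Integrated form of `tangent_le_of_pos` with respect to `μ + ν`; the linear part integrates to
`(1 - a) a + (1 - a)² = 1 - a`. -/
lemma le_integral_sq_add {φ : X → ℝ} (hφ : Measurable φ) (hφ1 : ∀ x, φ x ∈ Set.Icc (0 : ℝ) 1)
    {a : ℝ} (h0 : 0 < a) (h1 : a ≤ 1) :
    (1 - a) - hellingerSq μ ν
      ≤ (1 - a) / a * ∫ x, φ x ^ 2 ∂μ + ∫ x, (1 - φ x) ^ 2 ∂ν := by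
  set p := fun x => (μ.rnDeriv (μ + ν) x).toReal with hpd
  set q := fun x => (ν.rnDeriv (μ + ν) x).toReal with hqd
  have hp : Integrable p (μ + ν) := Measure.integrable_toReal_rnDeriv
  have hq : Integrable q (μ + ν) := Measure.integrable_toReal_rnDeriv
  have hone := integral_rnDeriv_add μ ν (f := fun _ => 1)
  simp only [mul_one, integral_const, probReal_univ, smul_eq_mul] at hone
  have bound := fun x => sq_mem_Icc (hφ1 x)
  have hpφ : Integrable (fun x => p x * φ x ^ 2) (μ + ν) := by
    refine hp.mono' (by fun_prop) (.of_forall fun x => ?_)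
    have h2 : 0 ≤ p x := ENNReal.toReal_nonneg
    rw [Real.norm_of_nonneg (mul_nonneg h2 (bound x).1.1)]
    exact mul_le_of_le_one_right h2 (bound x).1.2
  have hqφ : Integrable (fun x => q x * (1 - φ x) ^ 2) (μ + ν) := by
    refine hq.mono' (by fun_prop) (.of_forall fun x => ?_)
    have h2 : 0 ≤ q x := ENNReal.toReal_nonneg
    rw [Real.norm_of_nonneg (mul_nonneg h2 (bound x).2.1)]
    exact mul_le_of_le_one_right h2 (bound x).2.2
  have hH := integrable_hellinger_integrand μ ν
  have hlhs : ∫ x, ((1 - a) * a * p x + (1 - a) ^ 2 * q x - (√(p x) - √(q x)) ^ 2) ∂(μ + ν)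
      = (1 - a) - hellingerSq μ ν := by
    have hlin : ∫ x, ((1 - a) * a * p x + (1 - a) ^ 2 * q x) ∂(μ + ν) = 1 - a := by
      rw [integral_add (hp.const_mul _) (hq.const_mul _), integral_const_mul, integral_const_mul,
        hone.1, hone.2]
      ring
    exact (integral_sub ((hp.const_mul ((1 - a) * a)).add (hq.const_mul ((1 - a) ^ 2))) hH).trans
      (congrArg (· - hellingerSq μ ν) hlin)
  have hrhs : ∫ x, ((1 - a) / a * (p x * φ x ^ 2) + q x * (1 - φ x) ^ 2) ∂(μ + ν)
      = (1 - a) / a * ∫ x, φ x ^ 2 ∂μ + ∫ x, (1 - φ x) ^ 2 ∂ν := by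
    rw [integral_add (hpφ.const_mul _) hqφ, integral_const_mul,
      (integral_rnDeriv_add μ ν).1, (integral_rnDeriv_add μ ν).2]
  rw [← hlhs, ← hrhs]
  refine integral_mono (((hp.const_mul _).add (hq.const_mul _)).sub hH)
    ((hpφ.const_mul _).add hqφ) fun x => ?_
  have h := tangent_le_of_pos (s := √(p x)) (r := √(q x)) (f := φ x) h0 h1
  rw [Real.sq_sqrt ENNReal.toReal_nonneg, Real.sq_sqrt ENNReal.toReal_nonneg] at h
  simp only
  linarith

end Hellinger

variable {Pol Obs : Type*} [MeasurableSpace Pol] [MeasurableSpace Obs] {H : ℕ}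

/-- The countability assumption enters here: it provides a jointly measurable version of the
densities `d(P π)/d((P + Q) π)`. -/
lemma measurable_hellingerSq [MeasurableSpace.CountableOrCountablyGenerated Pol Obs]
    (P Q : Kernel Pol Obs) [IsMarkovKernel P] [IsMarkovKernel Q] :
    Measurable fun π => hellingerSq (P π) (Q π) := by
  have h : (fun π => hellingerSq (P π) (Q π)) = fun π => ∫ o,
      (√(P.rnDeriv (P + Q) π o).toReal - √(Q.rnDeriv (P + Q) π o).toReal) ^ 2 ∂((P + Q) π) := by
    funext π
    refine integral_congr_ae ?_
    filter_upwards [P.rnDeriv_eq_rnDeriv_measure (η := P + Q) (a := π),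
      Q.rnDeriv_eq_rnDeriv_measure (η := P + Q) (a := π)] with o h1 h2
    rw [h1, h2]; rfl
  rw [h]
  refine (StronglyMeasurable.integral_kernel_prod_right (κ := P + Q) (f := fun π o =>
    (√(P.rnDeriv (P + Q) π o).toReal - √(Q.rnDeriv (P + Q) π o).toReal) ^ 2)
    (Measurable.stronglyMeasurable ?_)).measurable
  have h1 := Kernel.measurable_rnDeriv P (P + Q)
  have h2 := Kernel.measurable_rnDeriv Q (P + Q)
  exact (h1.ennreal_toReal.sqrt.sub h2.ennreal_toReal.sqrt).pow_const 2

/-! ### Change of measure between history laws -/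

lemma integral_comp_of_mem_Icc {X Y : Type*} [MeasurableSpace X] [MeasurableSpace Y]
    {μ : Measure X} [IsProbabilityMeasure μ] {κ : Kernel X Y} [IsMarkovKernel κ] {f : Y → ℝ}
    {a b : ℝ} (hf : Measurable f) (h : ∀ y, f y ∈ Set.Icc a b) :
    ∫ y, f y ∂(κ ∘ₘ μ) = ∫ x, ∫ y, f y ∂(κ x) ∂μ := by
  rw [← Measure.snd_compProd, Measure.snd, integral_map (by fun_prop) hf.aestronglyMeasurable,
    Measure.integral_compProd (f := fun x : X × Y => f x.2)]
  exact integrable_of_mem_Icc (hf.comp measurable_snd) fun _ => h _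

namespace Algorithm
variable {𝓡 : Set (Obs → Fin H → ℝ)} {T : ℕ} (𝔄 : Algorithm Pol Obs 𝓡 T)

instance (t : ℕ) : IsMarkovKernel (𝔄.explore t) := 𝔄.markov_explore t

instance (R : 𝓡) : IsMarkovKernel (𝔄.out R) := 𝔄.markov_out R

lemma measurable_snoc {X : Type*} [MeasurableSpace X] (t : ℕ) :
    Measurable fun x : (Fin t → X) × X => (Fin.snoc x.1 x.2 : Fin (t + 1) → X) := by
  refine measurable_pi_lambda _ fun i => ?_
  induction i using Fin.lastCases with
  | last => simpa using measurable_snd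
  | cast j => simpa [Function.comp_def] using (measurable_pi_apply j).comp measurable_fst

instance isProbabilityMeasure_historyLaw (P : Kernel Pol Obs) [IsMarkovKernel P] (t : ℕ) :
    IsProbabilityMeasure (𝔄.historyLaw P t) := by
  induction t with
  | zero => unfold historyLaw; infer_instance
  | succ t ih =>
    unfold historyLaw
    exact Measure.isProbabilityMeasure_map (measurable_snoc t).aemeasurable

lemma integral_historyLaw_succ (P : Kernel Pol Obs) [IsMarkovKernel P] (t : ℕ)
    {f : (Fin (t + 1) → Pol × Obs) → ℝ} {a b : ℝ} (hf : Measurable f)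
    (h : ∀ x, f x ∈ Set.Icc a b) :
    ∫ y, f y ∂(𝔄.historyLaw P (t + 1)) = ∫ x, ∫ π, ∫ o,
      f (Fin.snoc (α := fun _ => Pol × Obs) x (π, o))
        ∂(P π) ∂(𝔄.explore t x) ∂(𝔄.historyLaw P t) := by
  have hm := hf.comp (measurable_snoc (X := Pol × Obs) t)
  rw [historyLaw, integral_map (measurable_snoc t).aemeasurable hf.aestronglyMeasurable,
    Measure.integral_compProd
      (f := fun z => f (Fin.snoc (α := fun _ => Pol × Obs) z.1 z.2))
      (integrable_of_mem_Icc hm fun _ => h _)]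
  refine integral_congr_ae (.of_forall fun x => ?_)
  simp only
  rw [ProbabilityTheory.integral_compProd]
  · rfl
  · exact integrable_of_mem_Icc (hm.comp (measurable_const.prodMk measurable_id)) fun _ => h _

/-- The conditional mean, given the history `x` of the first `t` episodes, of the squared
Hellinger distance between `P` and `Q` at the next explored policy. -/
def stepHellinger (P Q : Kernel Pol Obs) (t : ℕ) (x : Fin t → Pol × Obs) : ℝ :=
  ∫ π, hellingerSq (P π) (Q π) ∂(𝔄.explore t x)

section
variable [MeasurableSpace.CountableOrCountablyGenerated Pol Obs]
  (P Q : Kernel Pol Obs) [IsMarkovKernel P] [IsMarkovKernel Q]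

lemma measurable_stepHellinger (t : ℕ) : Measurable (𝔄.stepHellinger P Q t) :=
  (StronglyMeasurable.integral_kernel (κ := 𝔄.explore t)
    (measurable_hellingerSq P Q).stronglyMeasurable).measurable

lemma stepHellinger_mem_Icc (t : ℕ) (x : Fin t → Pol × Obs) :
    𝔄.stepHellinger P Q t x ∈ Set.Icc (0 : ℝ) 2 :=
  integral_mem_Icc (measurable_hellingerSq P Q)
    fun _ => ⟨hellingerSq_nonneg _ _, hellingerSq_le_two _ _⟩

/-- The effect of one episode on the test functional: with `α` and `β` the conditional means of
`φ²` under `P` and of `(1 - φ)²` under `Q`, the number `√α` is a test value for the preceding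
history, up to the expected squared Hellinger distance. -/
lemma le_integral_integral_sq_add (κ : Measure Pol) [IsProbabilityMeasure κ] {φ : Pol × Obs → ℝ}
    (hφ : Measurable φ) (hφ1 : ∀ z, φ z ∈ Set.Icc (0 : ℝ) 1) :
    (1 - √(∫ π, ∫ o, φ (π, o) ^ 2 ∂(P π) ∂κ)) ^ 2 - ∫ π, hellingerSq (P π) (Q π) ∂κ
      ≤ ∫ π, ∫ o, (1 - φ (π, o)) ^ 2 ∂(Q π) ∂κ := by
  have bound := fun z => sq_mem_Icc (hφ1 z)
  have hmP : Measurable fun π => ∫ o, φ (π, o) ^ 2 ∂(P π) :=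
    (StronglyMeasurable.integral_kernel_prod_right' (κ := P)
      (hφ.pow_const 2).stronglyMeasurable).measurable
  have hmQ : Measurable fun π => ∫ o, (1 - φ (π, o)) ^ 2 ∂(Q π) :=
    (StronglyMeasurable.integral_kernel_prod_right' (κ := Q)
      ((hφ.const_sub 1).pow_const 2).stronglyMeasurable).measurable
  have hbP : ∀ π, ∫ o, φ (π, o) ^ 2 ∂(P π) ∈ Set.Icc (0 : ℝ) 1 := fun π =>
    integral_mem_Icc ((hφ.comp measurable_prodMk_left).pow_const 2) fun _ => (bound _).1
  have hbQ : ∀ π, ∫ o, (1 - φ (π, o)) ^ 2 ∂(Q π) ∈ Set.Icc (0 : ℝ) 1 := fun π =>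
    integral_mem_Icc (((hφ.comp measurable_prodMk_left).const_sub 1).pow_const 2)
      fun _ => (bound _).2
  have hiP := integrable_of_mem_Icc (μ := κ) hmP hbP
  have hiQ := integrable_of_mem_Icc (μ := κ) hmQ hbQ
  have hiH := integrable_of_mem_Icc (μ := κ) (measurable_hellingerSq P Q)
    fun _ => ⟨hellingerSq_nonneg _ _, hellingerSq_le_two _ _⟩
  have hα := integral_mem_Icc (μ := κ) hmP hbP
  have key : ∀ a : ℝ, 0 < a → a ≤ 1 → (1 - a) - ∫ π, hellingerSq (P π) (Q π) ∂κ
      ≤ (1 - a) / a * ∫ π, ∫ o, φ (π, o) ^ 2 ∂(P π) ∂κ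
        + ∫ π, ∫ o, (1 - φ (π, o)) ^ 2 ∂(Q π) ∂κ := fun a h0 h1 => by
    have h := integral_mono ((integrable_const (1 - a)).sub hiH)
      ((hiP.const_mul ((1 - a) / a)).add hiQ) fun π =>
        le_integral_sq_add (P π) (Q π) (hφ.comp measurable_prodMk_left) (fun _ => hφ1 _) h0 h1
    have e1 := integral_sub (integrable_const (μ := κ) (1 - a)) hiH
    have e2 := integral_add (hiP.const_mul ((1 - a) / a)) hiQ
    simp only [integral_const, probReal_univ, one_smul, integral_const_mul] at e1 e2
    simp only [Pi.sub_apply, Pi.add_apply] at h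
    linarith
  set α := ∫ π, ∫ o, φ (π, o) ^ 2 ∂(P π) ∂κ
  have hs := Real.sq_sqrt hα.1
  rcases (Real.sqrt_nonneg α).eq_or_lt with h | h
  -- For `√α = 0` the weight `(1 - a) / a` is multiplied by `α = 0`, and `a` tends to `0`.
  · rw [← h] at hs ⊢
    have h0 : α = 0 := by rw [← hs]; norm_num
    rw [h0] at key
    refine le_of_forall_pos_lt_add fun e he => ?_
    have := key (min (e / 2) 1) (by positivity) (min_le_right _ _)
    have := min_le_left (e / 2) 1
    linarith
  -- The optimal weight is `a = √α`.
  · have := key (√α) h (Real.sqrt_le_one.mpr hα.2)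
    have e : (1 - √α) / √α * α = (1 - √α) * √α := by
      nth_rw 3 [← hs]
      field_simp
    rw [e] at this
    nlinarith

/-- The test functional of the two history laws stays above `1 / 2` minus the accumulated squared
Hellinger distances, measured under `Q`. In the induction step the test function on the shorter
history is the square root of the conditional mean of `φ²` under `P`. -/
lemma le_integral_sq_add_historyLaw (t : ℕ) {φ : (Fin t → Pol × Obs) → ℝ} (hφ : Measurable φ)
    (hφ1 : ∀ x, φ x ∈ Set.Icc (0 : ℝ) 1) :
    1 / 2 - ∑ s ∈ Finset.range t, ∫ x, 𝔄.stepHellinger P Q s x ∂(𝔄.historyLaw Q s)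
      ≤ ∫ x, φ x ^ 2 ∂(𝔄.historyLaw P t) + ∫ x, (1 - φ x) ^ 2 ∂(𝔄.historyLaw Q t) := by
  induction t with
  | zero =>
    simp only [historyLaw, Finset.range_zero, Finset.sum_empty, sub_zero]
    rw [integral_dirac' _ _ (hφ.pow_const 2).stronglyMeasurable,
      integral_dirac' _ _ ((hφ.const_sub 1).pow_const 2).stronglyMeasurable]
    nlinarith [sq_nonneg (2 * φ Fin.elim0 - 1)]
  | succ t ih =>
    have bound := fun x => sq_mem_Icc (hφ1 x)
    rw [𝔄.integral_historyLaw_succ P t (hφ.pow_const 2) fun x => (bound x).1,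
      𝔄.integral_historyLaw_succ Q t ((hφ.const_sub 1).pow_const 2) fun x => (bound x).2]
    set g : (Fin t → Pol × Obs) × Pol × Obs → ℝ :=
      fun z => φ (Fin.snoc (α := fun _ => Pol × Obs) z.1 z.2) with hg
    have hgm : Measurable g := hφ.comp (measurable_snoc t)
    have meas : ∀ (K : Kernel Pol Obs) [IsMarkovKernel K] (F : ℝ → ℝ), Measurable F →
        Measurable fun x => ∫ π, ∫ o, F (g (x, π, o)) ∂(K π) ∂(𝔄.explore t x) := by
      intro K _ F hF
      have h1 : Measurable fun y : (Fin t → Pol × Obs) × Pol =>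
          ∫ o, F (g (y.1, y.2, o)) ∂(Kernel.prodMkLeft (Fin t → Pol × Obs) K y) := by
        have : Measurable fun z : ((Fin t → Pol × Obs) × Pol) × Obs => F (g (z.1.1, z.1.2, z.2)) :=
          hF.comp (hgm.comp (by fun_prop))
        exact (StronglyMeasurable.integral_kernel_prod_right'
          (κ := Kernel.prodMkLeft (Fin t → Pol × Obs) K) this.stronglyMeasurable).measurable
      exact (StronglyMeasurable.integral_kernel_prod_right' (κ := 𝔄.explore t)
        h1.stronglyMeasurable).measurable
    have mem : ∀ (K : Kernel Pol Obs) [IsMarkovKernel K] (F : ℝ → ℝ), Measurable F →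
        (∀ z, F (g z) ∈ Set.Icc (0 : ℝ) 1) → ∀ x,
        ∫ π, ∫ o, F (g (x, π, o)) ∂(K π) ∂(𝔄.explore t x) ∈ Set.Icc (0 : ℝ) 1 := by
      intro K _ F hF hb x
      have h1 : Measurable fun z : Pol × Obs => F (g (x, z)) :=
        hF.comp (hgm.comp measurable_prodMk_left)
      refine integral_mem_Icc ?_ fun π => integral_mem_Icc ?_ fun o => hb _
      · exact (StronglyMeasurable.integral_kernel_prod_right' (κ := K)
          h1.stronglyMeasurable).measurable
      · exact h1.comp measurable_prodMk_left
    have hmα := meas P (fun y => y ^ 2) (by fun_prop)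
    have hmβ := meas Q (fun y => (1 - y) ^ 2) (by fun_prop)
    have hbα := mem P (fun y => y ^ 2) (by fun_prop) fun z => (bound _).1
    have hbβ := mem Q (fun y => (1 - y) ^ 2) (by fun_prop) fun z => (bound _).2
    set α := fun x => ∫ π, ∫ o, g (x, π, o) ^ 2 ∂(P π) ∂(𝔄.explore t x)
    set β := fun x => ∫ π, ∫ o, (1 - g (x, π, o)) ^ 2 ∂(Q π) ∂(𝔄.explore t x)
    have hstep : ∀ x, (1 - √(α x)) ^ 2 - 𝔄.stepHellinger P Q t x ≤ β x := fun x =>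
      le_integral_integral_sq_add P Q (𝔄.explore t x) (φ := fun z => g (x, z))
        (hgm.comp measurable_prodMk_left) fun _ => hφ1 _
    have hψ1 : ∀ x, √(α x) ∈ Set.Icc (0 : ℝ) 1 := fun x =>
      ⟨Real.sqrt_nonneg _, Real.sqrt_le_one.mpr (hbα x).2⟩
    have hψ := ih hmα.sqrt hψ1
    have eα : ∫ x, √(α x) ^ 2 ∂(𝔄.historyLaw P t) = ∫ x, α x ∂(𝔄.historyLaw P t) :=
      integral_congr_ae (.of_forall fun x => Real.sq_sqrt (hbα x).1)
    have i1 : Integrable (fun x => (1 - √(α x)) ^ 2) (𝔄.historyLaw Q t) :=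
      integrable_of_mem_Icc (a := 0) (b := 1) ((hmα.sqrt.const_sub 1).pow_const 2) fun x =>
        ⟨sq_nonneg _, by nlinarith [(hψ1 x).1, (hψ1 x).2]⟩
    have i2 := integrable_of_mem_Icc (μ := 𝔄.historyLaw Q t)
      (𝔄.measurable_stepHellinger P Q t) (𝔄.stepHellinger_mem_Icc P Q t)
    have hβ := integral_mono (i1.sub i2)
      (integrable_of_mem_Icc (μ := 𝔄.historyLaw Q t) hmβ hbβ) hstep
    have e3 := integral_sub i1 i2
    simp only [Pi.sub_apply] at hβ
    rw [Finset.sum_range_succ]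
    change _ ≤ ∫ x, α x ∂(𝔄.historyLaw P t) + ∫ x, β x ∂(𝔄.historyLaw Q t)
    linarith

/-- Change of measure from `P` to `Q`, obtained from the test function `φ = (1 + y) / 2`. -/
lemma integral_historyLaw_le {y : (Fin T → Pol × Obs) → ℝ} (hy : Measurable y)
    (hy1 : ∀ x, y x ∈ Set.Icc (0 : ℝ) 1) :
    ∫ x, y x ∂(𝔄.historyLaw Q T) ≤ 3 * ∫ x, y x ∂(𝔄.historyLaw P T)
      + 4 * ∑ s ∈ Finset.range T, ∫ x, 𝔄.stepHellinger P Q s x ∂(𝔄.historyLaw Q s) := by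
  have h := 𝔄.le_integral_sq_add_historyLaw P Q T (φ := fun x => (1 + y x) / 2)
    (by fun_prop) fun x => ⟨by linarith [(hy1 x).1], by linarith [(hy1 x).2]⟩
  have iP := integrable_of_mem_Icc (μ := 𝔄.historyLaw P T) hy hy1
  have iQ := integrable_of_mem_Icc (μ := 𝔄.historyLaw Q T) hy hy1
  have hP : ∫ x, ((1 + y x) / 2) ^ 2 ∂(𝔄.historyLaw P T)
      ≤ 1 / 4 + 3 / 4 * ∫ x, y x ∂(𝔄.historyLaw P T) := by
    calc _ ≤ ∫ x, (1 / 4 + 3 / 4 * y x) ∂(𝔄.historyLaw P T) := by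
          refine integral_mono (integrable_of_mem_Icc (a := 0) (b := 1) (by fun_prop) fun x => ?_)
            ((integrable_const _).add (iP.const_mul _)) fun x => ?_
          · obtain ⟨h0, h1⟩ := hy1 x
            exact ⟨sq_nonneg _, by nlinarith⟩
          · obtain ⟨h0, h1⟩ := hy1 x
            simp only
            nlinarith
      _ = _ := by
          rw [integral_add (integrable_const _) (iP.const_mul _), integral_const_mul]
          simp
  have hQ : ∫ x, (1 - (1 + y x) / 2) ^ 2 ∂(𝔄.historyLaw Q T)
      ≤ 1 / 4 - 1 / 4 * ∫ x, y x ∂(𝔄.historyLaw Q T) := by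
    calc _ ≤ ∫ x, (1 / 4 - 1 / 4 * y x) ∂(𝔄.historyLaw Q T) := by
          refine integral_mono (integrable_of_mem_Icc (a := 0) (b := 1) (by fun_prop) fun x => ?_)
            ((integrable_const _).sub (iQ.const_mul _)) fun x => ?_
          · obtain ⟨h0, h1⟩ := hy1 x
            exact ⟨sq_nonneg _, by nlinarith⟩
          · obtain ⟨h0, h1⟩ := hy1 x
            simp only
            nlinarith
      _ = _ := by
          rw [integral_sub (integrable_const _) (iQ.const_mul _), integral_const_mul]
          simp
  linarith
end
end Algorithm

/-! ### Values and gaps -/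

section Value
variable (P : Kernel Pol Obs) {R : Obs → Fin H → ℝ} (hRm : Measurable R)
include hRm

lemma measurable_value : Measurable (value P R) := by
  have : Measurable fun o => ∑ h, R o h :=
    Finset.measurable_sum _ fun h _ => (measurable_pi_apply h).comp hRm
  exact (StronglyMeasurable.integral_kernel (κ := P) this.stronglyMeasurable).measurable

lemma measurable_gap : Measurable (gap P R) := (measurable_value P hRm).const_sub _

variable [IsMarkovKernel P] (hR : ∀ o h, R o h ∈ Set.Icc (0 : ℝ) 1)
include hR

lemma value_mem_Icc (π : Pol) : value P R π ∈ Set.Icc (0 : ℝ) H := by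
  have : Measurable fun o => ∑ h, R o h :=
    Finset.measurable_sum _ fun h _ => (measurable_pi_apply h).comp hRm
  refine integral_mem_Icc this fun o => ⟨Finset.sum_nonneg fun h _ => (hR o h).1, ?_⟩
  simpa using Finset.sum_le_sum fun h (_ : h ∈ Finset.univ) => (hR o h).2

lemma gap_mem_Icc (π : Pol) : gap P R π ∈ Set.Icc (0 : ℝ) H := by
  have hv := value_mem_Icc P hRm hR
  have h1 : value P R π ≤ optValue P R :=
    le_ciSup ⟨(H : ℝ), Set.forall_mem_range.2 fun π => (hv π).2⟩ π
  have h2 : optValue P R ≤ H := Real.iSup_le (fun π => (hv π).2) (Nat.cast_nonneg H)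
  have := (hv π).1
  rw [gap]
  exact ⟨by linarith, by linarith⟩

end Value

/-- For the point mass at `Q` only the summand `Q' = Q` survives; the sum runs over all kernels. -/
lemma integral_sum_pure_hellingerSq (κ : Measure Pol) (P Q : Kernel Pol Obs) :
    ∫ π, ∑' Q', (PMF.pure Q Q').toReal * hellingerSq (P π) (Q' π) ∂κ
      = ∫ π, hellingerSq (P π) (Q π) ∂κ := by
  congr 1 with π
  rw [tsum_eq_single Q fun Q' h => by simp [PMF.pure_apply_of_ne _ _ h]]
  simp

/-- Only `C(T) ≥ 4` is needed. It holds since `min (2 T) V` is finite and at least `2`; the ratio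
bound is at least `3` by comparing a transition with itself on the whole space. -/
lemma four_le_logConst [Nonempty Pol] (𝓟 : Set (Kernel Pol Obs)) (h𝓟 : 𝓟.Nonempty)
    (h𝓟m : ∀ P ∈ 𝓟, IsMarkovKernel P) (T : ℕ) (hT : 1 ≤ T) : 4 ≤ logConst 𝓟 T := by
  obtain ⟨P, hP⟩ := h𝓟
  have := h𝓟m P hP
  have hV : 3 ≤ ratioBound 𝓟 := by
    have : (1 : ℝ≥0∞) ≤ ⨆ P ∈ 𝓟, ⨆ Q ∈ 𝓟, ⨆ π : Pol, ⨆ A : Set Obs, ⨆ _ : MeasurableSet A,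
        P π A / Q π A := by
      obtain ⟨π⟩ := ‹Nonempty Pol›
      refine le_iSup₂_of_le P hP (le_iSup₂_of_le P hP (le_iSup_of_le π
        (le_iSup₂_of_le Set.univ .univ ?_)))
      simp
    simpa [ratioBound] using mul_le_mul_right this 3
  have hT' : (1 : ℝ≥0∞) ≤ T := by exact_mod_cast hT
  have h2 : (2 : ℝ≥0∞) ≤ min (2 * (T : ℝ≥0∞)) (ratioBound 𝓟) :=
    le_min (by simpa using mul_le_mul_right hT' 2) (le_trans (by norm_num) hV)
  have hfin : min (2 * (T : ℝ≥0∞)) (ratioBound 𝓟) ≠ ∞ :=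
    ne_top_of_le_ne_top (by finiteness) (min_le_left _ _)
  have h3 : (2 : ℝ) ≤ (min (2 * (T : ℝ≥0∞)) (ratioBound 𝓟)).toReal := by
    simpa using ENNReal.toReal_mono hfin h2
  have h4 := Real.log_le_log (by norm_num) h3
  have := Real.log_two_gt_d9
  rw [logConst]
  linarith

/-! ### Suboptimality of an algorithm and the decision-estimation coefficient -/

namespace Algorithm
variable {𝓡 : Set (Obs → Fin H → ℝ)} {T : ℕ} (𝔄 : Algorithm Pol Obs 𝓡 T)

include 𝔄 in
/-- The algorithm draws a first policy from a probability measure. -/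
lemma nonempty_pol : Nonempty Pol :=
  nonempty_of_isProbabilityMeasure (𝔄.explore 0 Fin.elim0)

/-- The expected suboptimality of the output for the fixed reward `R`. -/
def expSubOptAt (P : Kernel Pol Obs) (R : 𝓡) : ℝ :=
  ∫ h, 𝔄.subOptAt P R h ∂(𝔄.historyLaw P T)

/-- The law of the policy explored in an episode chosen uniformly at random, when the algorithm
interacts with `Q`. -/
def exploreMixture (Q : Kernel Pol Obs) : Measure Pol :=
  (T : ℝ≥0∞)⁻¹ • ∑ s ∈ Finset.range T, 𝔄.explore s ∘ₘ 𝔄.historyLaw Q s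

lemma isProbabilityMeasure_exploreMixture (Q : Kernel Pol Obs) [IsMarkovKernel Q] (hT : 1 ≤ T) :
    IsProbabilityMeasure (𝔄.exploreMixture Q) := by
  refine ⟨?_⟩
  simp only [exploreMixture, Measure.smul_apply, Measure.coe_finsetSum, Finset.sum_apply,
    measure_univ, Finset.sum_const, Finset.card_range, nsmul_eq_mul, mul_one, smul_eq_mul]
  exact ENNReal.inv_mul_cancel (by simp; omega) (by simp)

lemma mul_integral_exploreMixture [MeasurableSpace.CountableOrCountablyGenerated Pol Obs]
    (P Q : Kernel Pol Obs) [IsMarkovKernel P] [IsMarkovKernel Q] (hT : 1 ≤ T) :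
    T * ∫ π, hellingerSq (P π) (Q π) ∂(𝔄.exploreMixture Q)
      = ∑ s ∈ Finset.range T, ∫ x, 𝔄.stepHellinger P Q s x ∂(𝔄.historyLaw Q s) := by
  have hm := measurable_hellingerSq P Q
  have hb : ∀ π, hellingerSq (P π) (Q π) ∈ Set.Icc (0 : ℝ) 2 := fun _ =>
    ⟨hellingerSq_nonneg _ _, hellingerSq_le_two _ _⟩
  have hT0 : (T : ℝ) ≠ 0 := by positivity
  rw [exploreMixture, integral_smul_measure,
    integral_finsetSum_measure fun s _ => integrable_of_mem_Icc hm hb]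
  simp only [ENNReal.toReal_inv, ENNReal.toReal_natCast, smul_eq_mul]
  rw [mul_inv_cancel_left₀ hT0]
  exact Finset.sum_congr rfl fun s _ => integral_comp_of_mem_Icc hm hb

section
variable (h𝓡m : ∀ R ∈ 𝓡, Measurable R) (h𝓡 : ∀ R ∈ 𝓡, ∀ o h, R o h ∈ Set.Icc (0 : ℝ) 1)
include h𝓡m h𝓡

lemma subOptAt_eq_integral_gap (P : Kernel Pol Obs) [IsMarkovKernel P] (R : 𝓡)
    (h : Fin T → Pol × Obs) : 𝔄.subOptAt P R h = ∫ π, gap P R.1 π ∂(𝔄.out R h) := by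
  have hv := integrable_of_mem_Icc (μ := 𝔄.out R h) (measurable_value P (h𝓡m R R.2))
    (value_mem_Icc P (h𝓡m R R.2) (h𝓡 R R.2))
  simp only [gap]
  rw [integral_sub (integrable_const _) hv]
  simp [subOptAt]

lemma subOptAt_mem_Icc (P : Kernel Pol Obs) [IsMarkovKernel P] (R : 𝓡)
    (h : Fin T → Pol × Obs) : 𝔄.subOptAt P R h ∈ Set.Icc (0 : ℝ) H := by
  rw [𝔄.subOptAt_eq_integral_gap h𝓡m h𝓡]
  exact integral_mem_Icc (measurable_gap P (h𝓡m R R.2)) (gap_mem_Icc P (h𝓡m R R.2) (h𝓡 R R.2))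

omit h𝓡 in
lemma measurable_subOptAt (P : Kernel Pol Obs) [IsMarkovKernel P] (R : 𝓡) :
    Measurable (𝔄.subOptAt P R) :=
  (StronglyMeasurable.integral_kernel (κ := 𝔄.out R)
    (measurable_value P (h𝓡m R R.2)).stronglyMeasurable).measurable.const_sub _

lemma expSubOptAt_mem_Icc (P : Kernel Pol Obs) [IsMarkovKernel P] (R : 𝓡) :
    𝔄.expSubOptAt P R ∈ Set.Icc (0 : ℝ) H :=
  integral_mem_Icc (𝔄.measurable_subOptAt h𝓡m P R) (𝔄.subOptAt_mem_Icc h𝓡m h𝓡 P R)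

/-- The suboptimality under `P` splits into its truncation at `ε`, to which the change of measure
applies, and an excess that is dominated by the suboptimality under `Q`. -/
lemma integral_subOptAt_le (P Q : Kernel Pol Obs) [IsMarkovKernel P] [IsMarkovKernel Q] (R : 𝓡)
    [MeasurableSpace.CountableOrCountablyGenerated Pol Obs]
    {ε : ℝ} (hε : 0 < ε) (hPQ : ∀ π, |gap P R.1 π - gap Q R.1 π| ≤ ε) :
    ∫ h, 𝔄.subOptAt P R h ∂(𝔄.historyLaw Q T) ≤ 3 * 𝔄.expSubOptAt P R + 𝔄.expSubOptAt Q R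
      + 4 * ε * ∑ s ∈ Finset.range T, ∫ x, 𝔄.stepHellinger P Q s x ∂(𝔄.historyLaw Q s) := by
  have hmP := 𝔄.measurable_subOptAt h𝓡m P R
  have hmQ := 𝔄.measurable_subOptAt h𝓡m Q R
  have hbP := 𝔄.subOptAt_mem_Icc h𝓡m h𝓡 P R
  have hbQ := 𝔄.subOptAt_mem_Icc h𝓡m h𝓡 Q R
  have hle : ∀ h, 𝔄.subOptAt P R h ≤ 𝔄.subOptAt Q R h + ε := fun h => by
    have iP := integrable_of_mem_Icc (μ := 𝔄.out R h) (measurable_gap P (h𝓡m R R.2))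
      (gap_mem_Icc P (h𝓡m R R.2) (h𝓡 R R.2))
    have iQ := integrable_of_mem_Icc (μ := 𝔄.out R h) (measurable_gap Q (h𝓡m R R.2))
      (gap_mem_Icc Q (h𝓡m R R.2) (h𝓡 R R.2))
    rw [𝔄.subOptAt_eq_integral_gap h𝓡m h𝓡 P, 𝔄.subOptAt_eq_integral_gap h𝓡m h𝓡 Q]
    have e : ∫ π, (gap Q R.1 π + ε) ∂(𝔄.out R h) = ∫ π, gap Q R.1 π ∂(𝔄.out R h) + ε := by
      rw [integral_add iQ (integrable_const _)]; simp
    rw [← e]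
    exact integral_mono iP (iQ.add (integrable_const _)) fun π => by
      have := (abs_le.1 (hPQ π)).2
      linarith
  -- The truncation at `ε`, rescaled to `[0, 1]`.
  set y : (Fin T → Pol × Obs) → ℝ := fun h => min (𝔄.subOptAt P R h / ε) 1
  have hy : Measurable y := (hmP.div_const ε).min measurable_const
  have hy1 : ∀ h, y h ∈ Set.Icc (0 : ℝ) 1 := fun h =>
    ⟨le_min (div_nonneg (hbP h).1 hε.le) zero_le_one, min_le_right _ _⟩
  have hkey := 𝔄.integral_historyLaw_le P Q hy hy1
  have hyQ := integrable_of_mem_Icc (μ := 𝔄.historyLaw Q T) hy hy1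
  have hyP := integrable_of_mem_Icc (μ := 𝔄.historyLaw P T) hy hy1
  have h1 : ∫ h, 𝔄.subOptAt P R h ∂(𝔄.historyLaw Q T)
      ≤ 𝔄.expSubOptAt Q R + ε * ∫ h, y h ∂(𝔄.historyLaw Q T) := by
    have iQ := integrable_of_mem_Icc (μ := 𝔄.historyLaw Q T) hmQ hbQ
    rw [expSubOptAt, ← integral_const_mul, ← integral_add iQ (hyQ.const_mul ε)]
    refine integral_mono (integrable_of_mem_Icc hmP hbP) (iQ.add (hyQ.const_mul ε)) fun h => ?_
    change 𝔄.subOptAt P R h ≤ 𝔄.subOptAt Q R h + ε * min (𝔄.subOptAt P R h / ε) 1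
    rw [mul_min_of_nonneg _ _ hε.le, mul_div_cancel₀ _ hε.ne', mul_one]
    rcases min_cases (𝔄.subOptAt P R h) ε with ⟨e, _⟩ | ⟨e, _⟩ <;> rw [e]
    · linarith [(hbQ h).1]
    · exact hle h
  have h2 : ε * ∫ h, y h ∂(𝔄.historyLaw P T) ≤ 𝔄.expSubOptAt P R := by
    rw [expSubOptAt, ← integral_const_mul]
    refine integral_mono (hyP.const_mul ε) (integrable_of_mem_Icc hmP hbP) fun h => ?_
    calc ε * y h ≤ ε * (𝔄.subOptAt P R h / ε) := by gcongr; exact min_le_left _ _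
      _ = 𝔄.subOptAt P R h := mul_div_cancel₀ _ hε.ne'
  nlinarith [mul_le_mul_of_nonneg_left hkey hε.le]

/-- The coefficient evaluated at the exploration and output distributions of the algorithm
interacting with the reference transition `Q`. -/
lemma exists_lt_of_lt_rfdecAt [MeasurableSpace.CountableOrCountablyGenerated Pol Obs]
    {𝓟 : Set (Kernel Pol Obs)} (h𝓟m : ∀ P ∈ 𝓟, IsMarkovKernel P) (hT : 1 ≤ T)
    {Q : Kernel Pol Obs} (hQ : Q ∈ 𝓟) {γ ε δ : ℝ} (hε : 0 < ε) (hεγ : 4 * ε * T ≤ γ)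
    (hδ : (δ : EReal) < rfdecAt γ (localized 𝓟 𝓡 ε Q) 𝓡 Q) :
    ∃ R : 𝓡, ∃ P ∈ 𝓟, δ < 3 * 𝔄.expSubOptAt P R + 𝔄.expSubOptAt Q R := by
  have := h𝓟m Q hQ
  have hexp := 𝔄.isProbabilityMeasure_exploreMixture Q hT
  have h := lt_of_lt_of_le hδ (iInf_le _ ⟨𝔄.exploreMixture Q, hexp⟩)
  obtain ⟨R, h⟩ := lt_iSup_iff.1 h
  obtain ⟨hR, h⟩ := lt_iSup_iff.1 h
  have h := lt_of_lt_of_le h (iInf_le _ ⟨𝔄.out ⟨R, hR⟩ ∘ₘ 𝔄.historyLaw Q T, inferInstance⟩)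
  obtain ⟨P, h⟩ := lt_iSup_iff.1 h
  obtain ⟨⟨hP, hPQ⟩, h⟩ := lt_iSup_iff.1 h
  have := h𝓟m P hP
  rw [EReal.coe_lt_coe_iff] at h
  simp only [ProbabilityMeasure.coe_mk] at h
  rw [integral_sum_pure_hellingerSq, integral_comp_of_mem_Icc (measurable_gap P (h𝓡m R hR))
    (gap_mem_Icc P (h𝓡m R hR) (h𝓡 R hR))] at h
  have hout : ∀ x, ∫ π, gap P R π ∂(𝔄.out ⟨R, hR⟩ x) = 𝔄.subOptAt P ⟨R, hR⟩ x :=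
    fun x => (𝔄.subOptAt_eq_integral_gap h𝓡m h𝓡 P ⟨R, hR⟩ x).symm
  simp only [hout] at h
  refine ⟨⟨R, hR⟩, P, hP, ?_⟩
  have hmain := 𝔄.integral_subOptAt_le h𝓡m h𝓡 P Q ⟨R, hR⟩ hε fun π => hPQ π R hR
  rw [← 𝔄.mul_integral_exploreMixture P Q hT] at hmain
  have hD : 0 ≤ ∫ π, hellingerSq (P π) (Q π) ∂(𝔄.exploreMixture Q) :=
    integral_nonneg fun _ => hellingerSq_nonneg _ _
  nlinarith [mul_le_mul_of_nonneg_right hεγ hD]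

lemma iSup_expSubOptAt_le_expSubOptRF (P : Kernel Pol Obs) [IsMarkovKernel P] :
    (⨆ R : 𝓡, (𝔄.expSubOptAt P R : EReal)) ≤ (𝔄.expSubOptRF P : EReal) := by
  refine iSup_le fun R => ?_
  have hb := 𝔄.subOptAt_mem_Icc h𝓡m h𝓡 P R
  have h : ENNReal.ofReal (𝔄.expSubOptAt P R) ≤ 𝔄.expSubOptRF P := by
    rw [expSubOptAt, ofReal_integral_eq_lintegral_ofReal
      (integrable_of_mem_Icc (𝔄.measurable_subOptAt h𝓡m P R) hb) (.of_forall fun h => (hb h).1)]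
    exact lintegral_mono fun h => le_iSup (fun R => ENNReal.ofReal (𝔄.subOptAt P R h)) R
  refine le_trans ?_ (EReal.coe_ennreal_le_coe_ennreal_iff.2 h)
  rw [EReal.coe_ennreal_ofReal]
  exact_mod_cast le_max_left _ _

end
end Algorithm

end RewardFree

end

/-! ### The lower bound -/

theorem proposition8 {Pol Obs : Type*} [MeasurableSpace Pol] [MeasurableSpace Obs]
    [MeasurableSpace.CountableOrCountablyGenerated Pol Obs] {H : ℕ}
    (𝓟 : Set (Kernel Pol Obs)) (h𝓟 : 𝓟.Nonempty) (h𝓟m : ∀ P ∈ 𝓟, IsMarkovKernel P)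
    (𝓡 : Set (Obs → Fin H → ℝ)) (h𝓡m : ∀ R ∈ 𝓡, Measurable R)
    (h𝓡 : ∀ R ∈ 𝓡, ∀ o h, R o h ∈ Set.Icc (0 : ℝ) 1)
    (T : ℕ) (hT : 1 ≤ T) (𝔄 : RewardFree.Algorithm Pol Obs 𝓡 T) :
    ∃ P ∈ 𝓟,
      (⨆ R : 𝓡, ((∫ h, 𝔄.subOptAt P R h ∂(𝔄.historyLaw P T) : ℝ) : EReal))
          ≤ ((𝔄.expSubOptRF P : ENNReal) : EReal) ∧
        ((1 / 6 : ℝ) : EReal) * (⨆ γ ∈ Set.Ioi (0 : ℝ), ⨆ Pbar ∈ 𝓟,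
            RewardFree.rfdecAt γ
              (RewardFree.localized 𝓟 𝓡 (RewardFree.radius 𝓟 T γ) Pbar) 𝓡 Pbar)
          ≤ ⨆ R : 𝓡, ((∫ h, 𝔄.subOptAt P R h ∂(𝔄.historyLaw P T) : ℝ) : EReal) := by
  have := 𝔄.nonempty_pol
  have hC := RewardFree.four_le_logConst 𝓟 h𝓟 h𝓟m T hT
  have hT' : (1 : ℝ) ≤ T := by exact_mod_cast hT
  have core : ∀ γ ∈ Set.Ioi (0 : ℝ), ∀ Q ∈ 𝓟, ∀ δ : ℝ,
      (δ : EReal) < RewardFree.rfdecAt γ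
        (RewardFree.localized 𝓟 𝓡 (RewardFree.radius 𝓟 T γ) Q) 𝓡 Q →
      ∃ R : 𝓡, ∃ P ∈ 𝓟, δ < 3 * 𝔄.expSubOptAt P R + 𝔄.expSubOptAt Q R := by
    intro γ hγ Q hQ δ hδ
    have hγ : 0 < γ := hγ
    refine 𝔄.exists_lt_of_lt_rfdecAt h𝓡m h𝓡 h𝓟m hT hQ ?_ ?_ hδ
    · rw [RewardFree.radius]; positivity
    · have : 4 * RewardFree.radius 𝓟 T γ * T = 4 / RewardFree.logConst 𝓟 T * γ := by
        rw [RewardFree.radius]; field_simp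
      rw [this]
      exact mul_le_of_le_one_left hγ.le ((div_le_one (by linarith)).2 hC)
  have hmem : ∀ P ∈ 𝓟, ∀ R : 𝓡, 𝔄.expSubOptAt P R ∈ Set.Icc (0 : ℝ) H := fun P hP R =>
    have := h𝓟m P hP
    𝔄.expSubOptAt_mem_Icc h𝓡m h𝓡 P R
  suffices ∃ P ∈ 𝓟, ((1 / 6 : ℝ) : EReal) * (⨆ γ ∈ Set.Ioi (0 : ℝ), ⨆ Pbar ∈ 𝓟,
      RewardFree.rfdecAt γ (RewardFree.localized 𝓟 𝓡 (RewardFree.radius 𝓟 T γ) Pbar) 𝓡 Pbar)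
        ≤ ⨆ R : 𝓡, (𝔄.expSubOptAt P R : EReal) by
    obtain ⟨P, hP, h⟩ := this
    have := h𝓟m P hP
    exact ⟨P, hP, 𝔄.iSup_expSubOptAt_le_expSubOptRF h𝓡m h𝓡 P, h⟩
  -- Without rewards both suprema in the second inequality are `⊥`, not `0`.
  rcases isEmpty_or_nonempty 𝓡 with hE | ⟨⟨R₀⟩⟩
  · obtain ⟨P, hP⟩ := h𝓟
    refine ⟨P, hP, ?_⟩
    have : (⨆ γ ∈ Set.Ioi (0 : ℝ), ⨆ Pbar ∈ 𝓟, RewardFree.rfdecAt γ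
        (RewardFree.localized 𝓟 𝓡 (RewardFree.radius 𝓟 T γ) Pbar) 𝓡 Pbar) = ⊥ := by
      refine le_bot_iff.1 (iSup₂_le fun γ hγ => iSup₂_le fun Q hQ => ?_)
      by_contra! hlt
      obtain ⟨δ, -, hδ⟩ := EReal.lt_iff_exists_real_btwn.1 hlt
      exact hE.elim (core γ hγ Q hQ δ hδ).choose
    rw [this, EReal.coe_mul_bot_of_pos (by norm_num)]
    exact bot_le
  obtain ⟨P₀, hP₀⟩ := h𝓟
  set S : Set ℝ := {b | ∃ P ∈ 𝓟, ∃ R : 𝓡, b = 𝔄.expSubOptAt P R} with hS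
  have hSne : S.Nonempty := ⟨_, P₀, hP₀, R₀, rfl⟩
  have hSbdd : BddAbove S := ⟨(H : ℝ), by rintro _ ⟨P, hP, R, rfl⟩; exact (hmem P hP R).2⟩
  have hle : ∀ P ∈ 𝓟, ∀ R, 𝔄.expSubOptAt P R ≤ sSup S := fun P hP R =>
    le_csSup hSbdd ⟨P, hP, R, rfl⟩
  have hX : (⨆ γ ∈ Set.Ioi (0 : ℝ), ⨆ Pbar ∈ 𝓟, RewardFree.rfdecAt γ
      (RewardFree.localized 𝓟 𝓡 (RewardFree.radius 𝓟 T γ) Pbar) 𝓡 Pbar)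
        ≤ ((4 * sSup S : ℝ) : EReal) := by
    refine iSup₂_le fun γ hγ => iSup₂_le fun Q hQ => ?_
    by_contra! hlt
    obtain ⟨R, P, hP, h⟩ := core γ hγ Q hQ _ hlt
    linarith [hle P hP R, hle Q hQ R]
  have h16 : (0 : EReal) ≤ ((1 / 6 : ℝ) : EReal) := by exact_mod_cast (by norm_num : (0:ℝ) ≤ 1 / 6)
  have hX' := mul_le_mul_of_nonneg_left hX h16
  rw [← EReal.coe_mul] at hX'
  have hfinal : ∃ P ∈ 𝓟, ∃ R : 𝓡, 1 / 6 * (4 * sSup S) ≤ 𝔄.expSubOptAt P R := by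
    -- Near-maximizers exist strictly below a positive supremum, and `4 / 6 < 1`.
    rcases le_or_gt (sSup S) 0 with h0 | h0
    · exact ⟨P₀, hP₀, R₀, le_trans (by linarith) (hmem P₀ hP₀ R₀).1⟩
    · obtain ⟨_, ⟨P, hP, R, rfl⟩, hlt⟩ :=
        exists_lt_of_lt_csSup hSne (show 1 / 6 * (4 * sSup S) < sSup S by linarith)
      exact ⟨P, hP, R, hlt.le⟩
  obtain ⟨P, hP, R, h⟩ := hfinal
  exact ⟨P, hP, hX'.trans ((EReal.coe_le_coe_iff.2 h).trans
    (le_iSup (fun R => (𝔄.expSubOptAt P R : EReal)) R))⟩
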